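/- Let $s\ge 1$ and let $\bm{k}=(k_1,\dots,k_s)$ be a tuple of positive integers; write $[r]=\{1,\dots,r\}$, $\log=\log_2$, and $(k;s)$ for the tuple $(k,\dots,k)$ of length $s$. For $t\ge 0$ and $r\ge 1$ let $\Phi_t(r;\bm{k})$ be the set of functions $\phi:\binom{[r]}{2}\to 2^{[s]}$ such that $|\phi(ij)|\ge t$ for all $ij\in\binom{[r]}{2}$ and, for every $c\in[s]$, the graph $\phi^{-1}(c):=\{ij\in\binom{[r]}{2}: c\in\phi(ij)\}$ on $[r]$ contains no clique of order $k_c$. A feasible solution is a triple $(r,\phi,\bm{\alpha})$ with $r\ge 1$, $\phi\in\Phi_2(r;\bm{k})$ and $\bm{\alpha}\in\mathbb{R}^r$ with all $\alpha_i>0$ and $\alpha_1+\dots+\alpha_r=1$. Let $$Q(\bm{k}):=\max\, q(\phi,\bm{\alpha}),\qquad q(\phi,\bm{\alpha}):=2\sum_{1\le i<j\le r}\alpha_i\alpha_j\log|\phi(ij)|,$$ where the maximum is over all feasible solutions $(r,\phi,\bm{\alpha})$. A feasible solution is optimal if it attains this maximum. For $\phi\in\Phi_0(r;\bm{k})$ and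 distinct $i,j\in[r]$, say that $i$ is a strong clone of $j$ under $\phi$ if $\phi(il)=\phi(jl)$ for all $l\in[r]\setminus\{i,j\}$ and $\phi(ij)=\emptyset$. The tuple $\bm{k}$ has the strong extension property if, for every optimal $(r^*,\phi^*,\bm{\alpha}^*)$ and every $\phi\in\Phi_0(r^*+1;\bm{k})$ which agrees with $\phi^*$ on $\binom{[r^*]}{2}$ and satisfies $$\sum_{i\in[r^*],\ \phi(\{i,r^*+1\})\ne\emptyset}\alpha^*_i\log|\phi(\{i,r^*+1\})|=Q(\bm{k}),$$ there is $j\in[r^*]$ such that $r^*+1$ is a strong clone of $j$ under $\phi$. Then each of the following has the strong extension property: $(k;2)$ and $(k;3)$ for every integer $k\ge 3$, $(3;4)$, $(3;6)$ and $(4;4)$. -/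

import Mathlib

namespace ErdosRothschild

/-- A function `φ` from the pairs of distinct elements of `[r]` to the subsets of `[s]`, written as a
symmetric function of two arguments. The diagonal carries no information and is set to `∅`. -/
structure Pattern (r s : ℕ) where
  toFun : Fin r → Fin r → Finset (Fin s)
  symm : ∀ i j, toFun i j = toFun j i
  diag : ∀ i, toFun i i = ∅

namespace Pattern

variable {r s : ℕ}

instance : CoeFun (Pattern r s) (fun _ => Fin r → Fin r → Finset (Fin s)) := ⟨toFun⟩

/-- The graph `φ⁻¹(c)` on `[r]`, whose edges are the pairs `ij` with `c ∈ φ(ij)`. -/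
def colourGraph (φ : Pattern r s) (c : Fin s) : SimpleGraph (Fin r) where
  Adj i j := c ∈ φ i j
  symm := ⟨fun i j h => by rw [φ.symm j i]; exact h⟩
  loopless := ⟨fun i h => by simp [φ.diag i] at h⟩

/-- The restriction of a pattern on `[r + 1]` to the pairs in `[r]`. -/
def restrict (φ : Pattern (r + 1) s) : Pattern r s where
  toFun i j := φ i.castSucc j.castSucc
  symm _ _ := φ.symm _ _
  diag _ := φ.diag _

/-- `i` is a clone of `j` under `φ`. -/
def IsClone (φ : Pattern r s) (i j : Fin r) : Prop :=
  i ≠ j ∧ (∀ l, l ≠ i → l ≠ j → φ i l = φ j l) ∧ (φ i j).card ≤ 1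

/-- `i` is a strong clone of `j` under `φ`. -/
def IsStrongClone (φ : Pattern r s) (i j : Fin r) : Prop :=
  φ.IsClone i j ∧ φ i j = ∅

end Pattern

/-- `Φ_t(r; k)`: every colour graph `φ⁻¹(c)` is `K_{k_c}`-free, and every pair of distinct elements
of `[r]` receives at least `t` colours. -/
def PatternSet {s : ℕ} (k : Fin s → ℕ) (t r : ℕ) : Set (Pattern r s) :=
  {φ | (∀ c, (φ.colourGraph c).CliqueFree (k c)) ∧ ∀ i j, i ≠ j → t ≤ (φ i j).card}

/-- `Δ^r`: vectors of positive reals with sum `1` (in particular, it is empty for `r = 0`). -/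
def Weighting (r : ℕ) : Set (Fin r → ℝ) :=
  {α | (∀ i, 0 < α i) ∧ ∑ i, α i = 1}

/-- `(r, φ, α)` is a feasible solution. -/
def IsFeasible {s : ℕ} (k : Fin s → ℕ) {r : ℕ} (φ : Pattern r s) (α : Fin r → ℝ) : Prop :=
  φ ∈ PatternSet k 2 r ∧ α ∈ Weighting r

/-- `q(φ, α) = 2 ∑_{i < j} α_i α_j log₂ |φ(ij)|`. -/
noncomputable def q {r s : ℕ} (φ : Pattern r s) (α : Fin r → ℝ) : ℝ :=
  2 * ∑ i, ∑ j ∈ Finset.Ioi i, α i * α j * Real.logb 2 ((φ i j).card : ℝ)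

/-- The values of `q` at the feasible solutions. -/
def feasibleValues {s : ℕ} (k : Fin s → ℕ) : Set ℝ :=
  {x | ∃ (r : ℕ) (φ : Pattern r s) (α : Fin r → ℝ), IsFeasible k φ α ∧ q φ α = x}

/-- `Q(k)`, the maximum of `q` over the feasible solutions. -/
noncomputable def Q {s : ℕ} (k : Fin s → ℕ) : ℝ := sSup (feasibleValues k)

/-- The set over which `Q(k)` is the supremum is bounded above, so that the supremum is genuine. -/
theorem bddAbove_feasibleValues {s : ℕ} (k : Fin s → ℕ) : BddAbove (feasibleValues k) := by
  refine ⟨2 * Real.logb 2 ((s : ℝ) + 1), ?_⟩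
  rintro x ⟨r, φ, α, ⟨-, hα, hsum⟩, rfl⟩
  have hL : 0 ≤ Real.logb 2 ((s : ℝ) + 1) :=
    Real.logb_nonneg (by norm_num) (by linarith [(Nat.cast_nonneg s : (0 : ℝ) ≤ s)])
  have hlog : ∀ i j, Real.logb 2 ((φ i j).card : ℝ) ≤ Real.logb 2 ((s : ℝ) + 1) := by
    intro i j
    rcases Nat.eq_zero_or_pos (φ i j).card with h | h
    · simpa [h] using hL
    · refine Real.logb_le_logb_of_le (by norm_num) (by exact_mod_cast h) ?_
      have : (φ i j).card ≤ s := by simpa using Finset.card_le_univ (φ i j)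
      exact_mod_cast this.trans (Nat.le_succ s)
  have hmain : ∑ i, ∑ j ∈ Finset.Ioi i, α i * α j * Real.logb 2 ((φ i j).card : ℝ)
      ≤ ∑ i, ∑ j, α i * α j * Real.logb 2 ((s : ℝ) + 1) := by
    refine Finset.sum_le_sum fun i _ => ?_
    refine (Finset.sum_le_sum fun j _ => mul_le_mul_of_nonneg_left (hlog i j)
      (mul_pos (hα i) (hα j)).le).trans ?_
    exact Finset.sum_le_sum_of_subset_of_nonneg (Finset.subset_univ _)
      fun j _ _ => mul_nonneg (mul_pos (hα i) (hα j)).le hL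
  have hone : ∑ i, ∑ j, α i * α j * Real.logb 2 ((s : ℝ) + 1) = Real.logb 2 ((s : ℝ) + 1) := by
    simp_rw [← Finset.sum_mul, ← Finset.mul_sum, hsum, mul_one, hsum, one_mul]
  unfold q
  linarith

/-- `(r, φ, α)` is an optimal solution. -/
def IsOptimal {s : ℕ} (k : Fin s → ℕ) {r : ℕ} (φ : Pattern r s) (α : Fin r → ℝ) : Prop :=
  IsFeasible k φ α ∧ q φ α = Q k

/-- `ext(φ, α)`, the contribution of the new vertex `r + 1` attached to the vertices of `[r]`. -/
noncomputable def ext {r s : ℕ} (φ : Pattern (r + 1) s) (α : Fin r → ℝ) : ℝ :=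
  ∑ i with φ (Fin.castSucc i) (Fin.last r) ≠ ∅,
    α i * Real.logb 2 ((φ (Fin.castSucc i) (Fin.last r)).card : ℝ)

/-- The strong extension property of `k`: whenever a new vertex `r + 1` is attached to an optimal
solution `(r, φ', α)` with the largest possible contribution `Q(k)`, it is a strong clone of some
vertex `j ∈ [r]`. -/
def StrongExtensionProperty {s : ℕ} (k : Fin s → ℕ) : Prop :=
  ∀ (r : ℕ) (φ' : Pattern r s) (α : Fin r → ℝ), IsOptimal k φ' α →
    ∀ φ ∈ PatternSet k 0 (r + 1), φ.restrict = φ' → ext φ α = Q k →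
      ∃ j : Fin r, φ.IsStrongClone (Fin.last r) j.castSucc

/-- `(k; s)`, the tuple `(k, …, k)` of length `s`. -/
def constTuple (k s : ℕ) : Fin s → ℕ := fun _ => k

end ErdosRothschild

/-! Bound the logarithm from above by a function of the number of colours whose average can be
controlled. Each colour graph is $K_{m+2}$-free (with $k=m+2$), so `weighted_turan` limits its
density to $m/(m+1)$. When a code shows the resulting bound on $q$ to be attained, every optimal
solution is tight in Turán for every colour: each colour graph is complete $(m+1)$-partite with
parts of equal weight, so vertices are words, $\phi(ij)$ is the set of coordinates where they
differ, and letters are uniform in each coordinate (`exists_code`).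

A new vertex must miss a whole part in each colour, so its colour sets lie inside the difference
sets to some word $y$ (`exists_word`). The mean distance to $y$ does not depend on $y$, so
contribution $Q$ makes every inequality tight: the colour sets equal the difference sets and all
distances to $y$ are tight for the logarithm bound. It remains to find a codeword at distance $0$,
which is the desired strong clone.

For $s\le 3$ and $(4;4)$ the bound is linear (`strongExtensionProperty_of_linear`) and the nonzero
tight distance exceeds the mean. For $(3;4)$ and $(3;6)$ a linear bound is too weak, and a bonus
$\kappa=\log 3-3/2$ is added for odd sizes. If all colour graphs are bipartite, odd pairs form a
cut, hence have weight at most $1/2$; `sum_oddInd_le` is a robust form, and $\kappa<1/6$ makes lost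
density cost more than extra odd pairs can gain. Moments of the distance to $y$ then force distance
$0$. -/

namespace ErdosRothschild

/-! ### Weighted Turán inequality and its extremal graphs -/

section WeightedTuran

variable {V : Type*} [DecidableEq V] (G : SimpleGraph V) [DecidableRel G.Adj] (w : V → ℝ)

/-- Twice the total weight of the edges of `G` inside `S`. -/
def edgeWeight (S : Finset V) : ℝ := ∑ i ∈ S, ∑ j ∈ S, if G.Adj i j then w i * w j else 0

variable {G w}

/-- The weighted Turán inequality, together with the structure of the graphs attaining equality. -/
theorem weighted_turan (hw : ∀ i, 0 < w i) (m : ℕ) : ∀ S : Finset V,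
    G.CliqueFreeOn (S : Set V) (m + 2) →
    ((m : ℝ) + 1) * edgeWeight G w S ≤ m * (∑ i ∈ S, w i) ^ 2 ∧
    (((m : ℝ) + 1) * edgeWeight G w S = m * (∑ i ∈ S, w i) ^ 2 →
      ∃ f : V → ℕ, (∀ i, f i ≤ m) ∧ (∀ i ∈ S, ∀ j ∈ S, G.Adj i j ↔ f i ≠ f j) ∧
        ∀ t ≤ m, ((m : ℝ) + 1) * ∑ i ∈ S with f i = t, w i = ∑ i ∈ S, w i) := by
  induction m with
  | zero =>
    intro S hS
    have hadj : ∀ i ∈ S, ∀ j ∈ S, ¬ G.Adj i j := by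
      intro i hi j hj hij
      refine hS (t := {i, j}) ?_ ?_
      · intro a ha
        simp only [Finset.coe_insert, Finset.coe_singleton, Set.mem_insert_iff,
          Set.mem_singleton_iff] at ha
        rcases ha with rfl | rfl
        · exact hi
        · exact hj
      · rw [SimpleGraph.isNClique_iff]
        refine ⟨?_, Finset.card_pair hij.ne⟩
        simp [SimpleGraph.isClique_iff, hij]
    have h0 : edgeWeight G w S = 0 :=
      Finset.sum_eq_zero fun i hi => Finset.sum_eq_zero fun j hj => if_neg (hadj i hi j hj)
    refine ⟨by simp [h0], fun _ => ⟨fun _ => 0, by simp, ?_, ?_⟩⟩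
    · intro i hi j hj
      simp [hadj i hi j hj]
    · intro t ht
      simp [Nat.le_zero.1 ht]
  | succ m ih =>
    intro S hS
    rcases S.eq_empty_or_nonempty with rfl | hne
    · exact ⟨by simp [edgeWeight], fun _ => ⟨fun _ => 0, by simp, by simp, by simp⟩⟩
    -- For `v` of maximum weighted degree, the neighbourhood `N` falls under the induction
    -- hypothesis, and the non-neighbours `B` become the new part in the equality case.
    obtain ⟨v, hvS, hv⟩ := S.exists_max_image (fun i => ∑ j ∈ S, if G.Adj i j then w j else 0) hne
    set N := S.filter (fun i => G.Adj v i) with hN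
    set B := S.filter (fun i => ¬ G.Adj v i) with hB
    set d : V → ℝ := fun i => ∑ j ∈ S, if G.Adj i j then w j else 0 with hd
    have hNfree : G.CliqueFreeOn (N : Set V) (m + 2) := by
      intro t ht hc
      refine hS (t := insert v t) ?_ (hc.insert fun b hb => ?_)
      · intro a ha
        rw [Finset.coe_insert, Set.mem_insert_iff] at ha
        rcases ha with rfl | ha
        · exact hvS
        · exact Finset.mem_coe.2 (Finset.mem_filter.1 (Finset.mem_coe.1 (ht ha))).1
      · exact (Finset.mem_filter.1 (Finset.mem_coe.1 (ht hb))).2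
    obtain ⟨ihle, iheq⟩ := ih N hNfree
    have hsplit : ∀ g : V → ℝ, ∑ i ∈ S, g i = ∑ i ∈ N, g i + ∑ i ∈ B, g i := fun g =>
      (Finset.sum_filter_add_sum_filter_not S _ g).symm
    set D := ∑ i ∈ N, w i with hD
    set W := ∑ i ∈ S, w i with hW
    have hdv : d v = D := by simp [hd, hD, hN, Finset.sum_filter]
    have hdle : ∀ u ∈ S, d u ≤ D := fun u hu => hdv ▸ hv u hu
    set E : V → V → ℝ := fun i j => if G.Adj i j then w i * w j else 0 with hE
    have hE0 : ∀ i j, 0 ≤ E i j := fun i j => by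
      simp only [hE]; split_ifs
      · exact (mul_pos (hw i) (hw j)).le
      · exact le_rfl
    have hEsymm : ∀ i j, E i j = E j i := fun i j => by
      simp only [hE, G.adj_comm i j, mul_comm (w i)]
    have hNB : ∑ i ∈ N, ∑ j ∈ B, E i j = ∑ i ∈ B, ∑ j ∈ N, E i j := by
      rw [Finset.sum_comm]
      exact Finset.sum_congr rfl fun i _ => Finset.sum_congr rfl fun j _ => hEsymm _ _
    have hBd : ∑ u ∈ B, w u * d u = ∑ i ∈ B, ∑ j ∈ N, E i j + ∑ i ∈ B, ∑ j ∈ B, E i j := by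
      rw [← Finset.sum_add_distrib]
      refine Finset.sum_congr rfl fun u _ => ?_
      rw [← hsplit, hd, Finset.mul_sum]
      exact Finset.sum_congr rfl fun j _ => by simp [hE, mul_ite]
    have htot : edgeWeight G w S = edgeWeight G w N + 2 * ∑ u ∈ B, w u * d u
        - ∑ i ∈ B, ∑ j ∈ B, E i j := by
      have h1 : edgeWeight G w S = ∑ i ∈ S, ∑ j ∈ S, E i j := rfl
      have h2 : edgeWeight G w N = ∑ i ∈ N, ∑ j ∈ N, E i j := rfl
      rw [h1, h2, hBd, hsplit, Finset.sum_congr rfl fun i _ => hsplit (E i),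
        Finset.sum_congr rfl fun i (_ : i ∈ B) => hsplit (E i), Finset.sum_add_distrib,
        Finset.sum_add_distrib, hNB]
      ring
    have hWB : ∑ u ∈ B, w u = W - D := by rw [hW, hsplit]; ring
    have hslack : ∑ u ∈ B, w u * (D - d u) = (W - D) * D - ∑ u ∈ B, w u * d u := by
      rw [← hWB, Finset.sum_mul, ← Finset.sum_sub_distrib]
      exact Finset.sum_congr rfl fun u _ => by ring
    have hterm : ∀ u ∈ B, 0 ≤ w u * (D - d u) := fun u hu =>
      mul_nonneg (hw u).le (sub_nonneg.2 (hdle u (Finset.mem_filter.1 hu).1))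
    have hslack0 : 0 ≤ ∑ u ∈ B, w u * (D - d u) := Finset.sum_nonneg hterm
    have hBB0 : 0 ≤ ∑ i ∈ B, ∑ j ∈ B, E i j :=
      Finset.sum_nonneg fun i _ => Finset.sum_nonneg fun j _ => hE0 i j
    set X := ∑ u ∈ B, w u * d u
    set Y := ∑ u ∈ B, w u * (D - d u) with hY
    set Z := ∑ i ∈ B, ∑ j ∈ B, E i j with hZ
    set F := edgeWeight G w N
    have hm : (0 : ℝ) < (m : ℝ) + 1 := by positivity
    push_cast
    -- The gap in the inequality is a sum of three nonnegative deficits: imbalance between `N` and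
    -- `B`, the Turán deficit inside `N`, and `B` failing to be independent and completely joined to
    -- `N`. At equality each one vanishes.
    have key : ((m : ℝ) + 1) * (((m : ℝ) + 1 + 1) * edgeWeight G w S) =
        ((m : ℝ) + 1) * (((m : ℝ) + 1) * W ^ 2) - (((m : ℝ) + 1) * W - ((m : ℝ) + 2) * D) ^ 2
        - ((m : ℝ) + 2) * (m * D ^ 2 - ((m : ℝ) + 1) * F)
        - ((m : ℝ) + 1) * ((m : ℝ) + 2) * (2 * Y + Z) := by
      rw [htot, hslack]; ring
    have hp1 : 0 ≤ ((m : ℝ) + 2) * (m * D ^ 2 - ((m : ℝ) + 1) * F) :=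
      mul_nonneg (by positivity) (sub_nonneg.2 ihle)
    have hp2 : 0 ≤ ((m : ℝ) + 1) * ((m : ℝ) + 2) * (2 * Y + Z) := by positivity
    refine ⟨le_of_mul_le_mul_left (by nlinarith [sq_nonneg (((m : ℝ) + 1) * W - ((m : ℝ) + 2) * D)])
      hm, fun heq => ?_⟩
    rw [heq] at key
    have hsq := sq_nonneg (((m : ℝ) + 1) * W - ((m : ℝ) + 2) * D)
    have hWD : ((m : ℝ) + 1) * W - ((m : ℝ) + 2) * D = 0 := by
      have : (((m : ℝ) + 1) * W - ((m : ℝ) + 2) * D) ^ 2 = 0 := by linarith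
      exact pow_eq_zero_iff (two_ne_zero) |>.1 this
    have hF : ((m : ℝ) + 1) * F = m * D ^ 2 := by
      have h : ((m : ℝ) + 2) * (m * D ^ 2 - ((m : ℝ) + 1) * F) = 0 := by linarith
      rcases mul_eq_zero.1 h with h | h
      · linarith
      · linarith
    have hYZ : 2 * Y + Z = 0 := by
      have h : ((m : ℝ) + 1) * ((m : ℝ) + 2) * (2 * Y + Z) = 0 := by linarith
      exact (mul_eq_zero.1 h).resolve_left (by positivity)
    have hY0 : Y = 0 := by linarith
    have hZ0 : Z = 0 := by linarith
    have hBind : ∀ i ∈ B, ∀ j ∈ B, ¬ G.Adj i j := by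
      intro i hi j hj hij
      have h1 := (Finset.sum_eq_zero_iff_of_nonneg fun i _ =>
        Finset.sum_nonneg fun j _ => hE0 i j).1 hZ0 i hi
      have h2 := (Finset.sum_eq_zero_iff_of_nonneg fun j _ => hE0 i j).1 h1 j hj
      simp only [hE, if_pos hij] at h2
      exact (mul_pos (hw i) (hw j)).ne' h2
    have hBN : ∀ i ∈ B, ∀ j ∈ N, G.Adj i j := by
      intro i hi j hj
      have h1 := (Finset.sum_eq_zero_iff_of_nonneg hterm).1 hY0 i hi
      have h2 : D - d i = 0 := (mul_eq_zero.1 h1).resolve_left (hw i).ne'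
      have h3 : d i = ∑ j ∈ N, if G.Adj i j then w j else 0 := by
        rw [hd]; simp only []; rw [hsplit, add_eq_left]
        exact Finset.sum_eq_zero fun j hj => if_neg (hBind i hi j hj)
      have h4 : ∑ j ∈ N, (w j - if G.Adj i j then w j else 0) = 0 := by
        rw [Finset.sum_sub_distrib, ← h3]; exact h2
      have h5 := (Finset.sum_eq_zero_iff_of_nonneg fun j _ => by
        split_ifs
        · simp
        · simpa using (hw j).le).1 h4 j hj
      by_contra hcon
      rw [if_neg hcon, sub_zero] at h5
      exact (hw j).ne' h5
    obtain ⟨f, hfm, hfadj, hfw⟩ := iheq hF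
    have hmemN : ∀ {i}, i ∈ S → G.Adj v i → i ∈ N := fun h h' => Finset.mem_filter.2 ⟨h, h'⟩
    have hmemB : ∀ {i}, i ∈ S → ¬ G.Adj v i → i ∈ B := fun h h' => Finset.mem_filter.2 ⟨h, h'⟩
    refine ⟨fun i => if G.Adj v i then f i else m + 1, ?_, ?_, ?_⟩
    · intro i
      dsimp only
      split_ifs
      · exact (hfm i).trans (Nat.le_succ m)
      · exact le_rfl
    · intro i hi j hj
      have hfi := hfm i
      have hfj := hfm j
      by_cases h1 : G.Adj v i <;> by_cases h2 : G.Adj v j <;> simp only [h1, h2, if_true, if_false]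
      · exact hfadj i (hmemN hi h1) j (hmemN hj h2)
      · exact iff_of_true (hBN j (hmemB hj h2) i (hmemN hi h1)).symm (by omega)
      · exact iff_of_true (hBN i (hmemB hi h1) j (hmemN hj h2)) (by omega)
      · exact iff_of_false (hBind i (hmemB hi h1) j (hmemB hj h2)) (by simp)
    · intro t ht
      rcases Nat.lt_or_eq_of_le ht with hlt | rfl
      · have hs : S.filter (fun i => (if G.Adj v i then f i else m + 1) = t)
            = N.filter (fun i => f i = t) := by
          ext i
          simp only [hN, Finset.mem_filter]
          by_cases h1 : G.Adj v i
          · simp [h1]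
          · simp only [h1, if_false, and_false, false_and, iff_false]; omega
        rw [hs]
        have := hfw t (by omega)
        -- The induction hypothesis compares a part with `D`; `hWD` converts `D` into `W`.
        have h6 : ((m : ℝ) + 1) * (((m : ℝ) + 1 + 1) * ∑ i ∈ N with f i = t, w i) =
            ((m : ℝ) + 1) * W := by
          linear_combination ((m : ℝ) + 2) * this - hWD
        exact mul_left_cancel₀ hm.ne' h6
      · have hs : S.filter (fun i => (if G.Adj v i then f i else m + 1) = m + 1) = B := by
          ext i
          simp only [hB, Finset.mem_filter]
          have := hfm i
          by_cases h1 : G.Adj v i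
          · simp only [h1, if_true, not_true, and_false, iff_false]; omega
          · simp [h1]
        rw [hs, hWB]
        linear_combination hWD

end WeightedTuran

/-! ### Colour densities, codes and lower bounds for Q -/

variable {r s m : ℕ}

/-- The weight of the ordered pairs whose colour set contains `c`. -/
def density (φ : Pattern r s) (α : Fin r → ℝ) (c : Fin s) : ℝ :=
  ∑ i, ∑ j, if c ∈ φ i j then α i * α j else 0

instance (φ : Pattern r s) (c : Fin s) : DecidableRel (φ.colourGraph c).Adj :=
  fun i j => inferInstanceAs (Decidable (c ∈ φ i j))

theorem edgeWeight_colourGraph (φ : Pattern r s) (α : Fin r → ℝ) (c : Fin s) :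
    edgeWeight (φ.colourGraph c) α Finset.univ = density φ α c := rfl

theorem density_le {φ : Pattern r s} {α : Fin r → ℝ} {c : Fin s} (hα : α ∈ Weighting r)
    (hφ : (φ.colourGraph c).CliqueFree (m + 2)) : ((m : ℝ) + 1) * density φ α c ≤ m := by
  have h := (weighted_turan hα.1 m Finset.univ
    (by simpa [SimpleGraph.cliqueFreeOn_univ] using hφ)).1
  rwa [edgeWeight_colourGraph, hα.2, one_pow, mul_one] at h

/-- The set of coordinates in which two words differ. -/
def diffSet (x y : Fin s → Fin m) : Finset (Fin s) := {c | x c ≠ y c}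

@[simp]
theorem mem_diffSet {x y : Fin s → Fin m} {c : Fin s} : c ∈ diffSet x y ↔ x c ≠ y c := by
  simp [diffSet]

/-- A pattern whose colour graphs all attain equality in the weighted Turán inequality comes from
a code in which every coordinate is uniformly distributed. -/
theorem exists_code {φ : Pattern r s} {α : Fin r → ℝ} (hα : α ∈ Weighting r)
    (hφ : ∀ c, (φ.colourGraph c).CliqueFree (m + 2))
    (hd : ∀ c, ((m : ℝ) + 1) * density φ α c = m) :
    ∃ x : Fin r → Fin s → Fin (m + 1), (∀ i j, φ i j = diffSet (x i) (x j)) ∧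
      ∀ c t, ((m : ℝ) + 1) * ∑ i with x i c = t, α i = 1 := by
  have h : ∀ c, ∃ f : Fin r → ℕ, (∀ i, f i ≤ m) ∧ (∀ i j, c ∈ φ i j ↔ f i ≠ f j) ∧
      ∀ t ≤ m, ((m : ℝ) + 1) * ∑ i with f i = t, α i = 1 := by
    intro c
    obtain ⟨f, h1, h2, h3⟩ := (weighted_turan hα.1 m Finset.univ
      (by simpa [SimpleGraph.cliqueFreeOn_univ] using hφ c)).2
      (by rw [edgeWeight_colourGraph, hα.2, one_pow, mul_one, hd])
    refine ⟨f, h1, fun i j => h2 i (Finset.mem_univ i) j (Finset.mem_univ j), fun t ht => ?_⟩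
    rw [h3 t ht, hα.2]
  choose f h1 h2 h3 using h
  refine ⟨fun i c => ⟨f c i, Nat.lt_succ_of_le (h1 c i)⟩, fun i j => ?_, fun c t => ?_⟩
  · ext c
    simp [h2]
  · simp only [Fin.ext_iff]
    exact h3 c t (Nat.le_of_lt_succ t.2)

/-- A vertex added to a code without creating large monochromatic cliques is dominated by a word. -/
theorem exists_word {φ : Pattern (r + 1) s} (hφ : ∀ c, (φ.colourGraph c).CliqueFree (m + 2))
    {x : Fin r → Fin s → Fin (m + 1)} (hx : ∀ i j, φ.restrict i j = diffSet (x i) (x j)) :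
    ∃ y : Fin s → Fin (m + 1), ∀ i : Fin r, φ i.castSucc (Fin.last r) ⊆ diffSet (x i) y := by
  have h : ∀ c, ∃ t : Fin (m + 1), ∀ i : Fin r, c ∈ φ i.castSucc (Fin.last r) → x i c ≠ t := by
    intro c
    -- Otherwise each of the `m + 1` letters is used by a vertex joined to the new one in colour
    -- `c`. These vertices differ pairwise in coordinate `c`, so with the new vertex they form a
    -- clique of order `m + 2`.
    by_contra! hcon
    choose g hg hgx using hcon
    have hinj : Function.Injective fun t => (g t).castSucc := fun a b hab => by
      rw [← hgx a, ← hgx b, Fin.castSucc_injective _ hab]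
    have hclique : (φ.colourGraph c).IsNClique (m + 1) (Finset.univ.map ⟨_, hinj⟩) := by
      rw [SimpleGraph.isNClique_iff]
      refine ⟨?_, by simp⟩
      intro a ha b hb hab
      simp only [Finset.coe_map, Function.Embedding.coeFn_mk, Finset.coe_univ, Set.image_univ,
        Set.mem_range] at ha hb
      obtain ⟨a, rfl⟩ := ha
      obtain ⟨b, rfl⟩ := hb
      change c ∈ φ.restrict (g a) (g b)
      rw [hx, mem_diffSet, hgx, hgx]
      rintro rfl
      exact hab rfl
    refine hφ c _ (hclique.insert (a := Fin.last r) fun b hb => ?_)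
    obtain ⟨t, -, rfl⟩ := Finset.mem_map.1 hb
    exact ((φ.colourGraph c).adj_comm _ _).1 (hg t)
  choose y hy using h
  exact ⟨y, fun i c hc => mem_diffSet.2 (hy c i hc)⟩

/-- The expected distance from a word to a uniformly distributed code. -/
theorem sum_mul_card_diffSet {x : Fin r → Fin s → Fin (m + 1)} {α : Fin r → ℝ}
    (hα : α ∈ Weighting r) (hx : ∀ c t, ((m : ℝ) + 1) * ∑ i with x i c = t, α i = 1)
    (y : Fin s → Fin (m + 1)) :
    ((m : ℝ) + 1) * ∑ i, α i * ((diffSet (x i) y).card : ℝ) = m * s := by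
  have h1 : ∀ i, α i * ((diffSet (x i) y).card : ℝ) = ∑ c, (α i - if x i c = y c then α i else 0) := by
    intro i
    rw [diffSet, Finset.card_filter, Nat.cast_sum, Finset.mul_sum]
    refine Finset.sum_congr rfl fun c _ => ?_
    by_cases h : x i c = y c <;> simp [h]
  rw [Finset.sum_congr rfl fun i _ => h1 i, Finset.sum_comm, Finset.mul_sum]
  have h2 : ∀ c, ((m : ℝ) + 1) * ∑ i, (α i - if x i c = y c then α i else 0) = m := by
    intro c
    have := hx c (y c)
    rw [Finset.sum_filter] at this
    rw [Finset.sum_sub_distrib, mul_sub, this, hα.2]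
    ring
  rw [Finset.sum_congr rfl fun c _ => h2 c]
  simp [mul_comm]

/-- A vertex represented by a word is a strong clone of any vertex it shares no colour with. -/
theorem isStrongClone_of_word {φ : Pattern (r + 1) s} {x : Fin r → Fin s → Fin (m + 1)}
    (hx : ∀ i j, φ.restrict i j = diffSet (x i) (x j)) {y : Fin s → Fin (m + 1)}
    (hy : ∀ i : Fin r, φ i.castSucc (Fin.last r) = diffSet (x i) y) {j : Fin r}
    (hj : diffSet (x j) y = ∅) : φ.IsStrongClone (Fin.last r) j.castSucc := by
  have hxy : x j = y := by
    funext c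
    by_contra hc
    exact Finset.notMem_empty c (hj ▸ mem_diffSet.2 hc)
  have h0 : φ (Fin.last r) j.castSucc = ∅ := by rw [φ.symm, hy, hj]
  refine ⟨⟨(Fin.castSucc_lt_last j).ne', fun l hl _ => ?_, by simp [h0]⟩, h0⟩
  obtain ⟨l, rfl⟩ := Fin.exists_castSucc_eq.2 hl
  rw [φ.symm, hy, φ.symm j.castSucc]
  exact (hxy ▸ hx l j).symm

/-- The diagonal adds nothing, since `Real.logb 2 0 = 0`; symmetry accounts for the factor 2. -/
theorem q_eq_sum (φ : Pattern r s) (α : Fin r → ℝ) :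
    q φ α = ∑ i, ∑ j, α i * α j * Real.logb 2 ((φ i j).card : ℝ) := by
  set F : Fin r → Fin r → ℝ := fun i j => α i * α j * Real.logb 2 ((φ i j).card : ℝ) with hF
  have hsymm : ∀ i j, F i j = F j i := fun i j => by simp only [hF, φ.symm i j, mul_comm (α i)]
  have hdiag : ∀ i, F i i = 0 := fun i => by simp [hF, φ.diag]
  have h1 : ∀ i, ∑ j, F i j = ∑ j ∈ Finset.Ioi i, F i j + ∑ j ∈ Finset.Iio i, F i j := by
    intro i
    rw [← Finset.sum_union (Finset.disjoint_left.2 fun a ha hb => by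
      rw [Finset.mem_Ioi] at ha; rw [Finset.mem_Iio] at hb; exact lt_asymm ha hb)]
    symm
    refine Finset.sum_subset (Finset.subset_univ _) fun j _ hj => ?_
    simp only [Finset.mem_union, Finset.mem_Ioi, Finset.mem_Iio, not_or, not_lt] at hj
    rw [le_antisymm hj.1 hj.2, hdiag]
  have h2 : ∑ i, ∑ j ∈ Finset.Iio i, F i j = ∑ i, ∑ j ∈ Finset.Ioi i, F i j := by
    rw [Finset.sum_comm' (t' := Finset.univ) (s' := fun j => Finset.Ioi j) (by simp)]
    exact Finset.sum_congr rfl fun i _ => Finset.sum_congr rfl fun j _ => hsymm _ _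
  change 2 * ∑ i, ∑ j ∈ Finset.Ioi i, F i j = ∑ i, ∑ j, F i j
  rw [Finset.sum_congr rfl fun i _ => h1 i, Finset.sum_add_distrib, h2, two_mul]

theorem ext_eq_sum (φ : Pattern (r + 1) s) (α : Fin r → ℝ) :
    ext φ α = ∑ i, α i * Real.logb 2 ((φ (Fin.castSucc i) (Fin.last r)).card : ℝ) := by
  rw [ext, Finset.sum_filter]
  refine Finset.sum_congr rfl fun i _ => ?_
  split_ifs with h
  · rfl
  · rw [not_not.1 h]; simp

/-- Double counting of pairs together with one of their colours. -/
theorem sum_mul_card (φ : Pattern r s) (α : Fin r → ℝ) :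
    ∑ i, ∑ j, α i * α j * ((φ i j).card : ℝ) = ∑ c, density φ α c := by
  have h1 : ∀ i j, α i * α j * ((φ i j).card : ℝ) = ∑ c, if c ∈ φ i j then α i * α j else 0 := by
    intro i j
    rw [← Finset.sum_filter, Finset.sum_const, nsmul_eq_mul, mul_comm]
    simp
  simp_rw [h1, density]
  rw [Finset.sum_congr rfl fun i _ => Finset.sum_comm, Finset.sum_comm]

/-- The pattern of a code. -/
def codePattern (x : Fin r → Fin s → Fin m) : Pattern r s where
  toFun i j := diffSet (x i) (x j)
  symm i j := by ext c; simp [eq_comm]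
  diag i := by ext c; simp

/-- The letters in coordinate `c` are a proper colouring with `m + 1` colours. -/
theorem codePattern_cliqueFree (x : Fin r → Fin s → Fin (m + 1)) (c : Fin s) :
    ((codePattern x).colourGraph c).CliqueFree (m + 2) :=
  SimpleGraph.Colorable.cliqueFree (n := m + 1)
    ⟨SimpleGraph.Coloring.mk (fun i => x i c) fun {_ _} h => mem_diffSet.1 h⟩ (Nat.lt_succ_self _)

/-- A lower bound for `Q` from a code in which the distances to every word have the same
distribution. -/
theorem le_Q_of_code (hr : 0 < r) (x : Fin r → Fin s → Fin (m + 1))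
    (hx : ∀ i j, i ≠ j → 2 ≤ (diffSet (x i) (x j)).card) {v : ℝ}
    (hv : ∀ i, ∑ j, Real.logb 2 ((diffSet (x i) (x j)).card : ℝ) = r * v) :
    v ≤ Q (constTuple (m + 2) s) := by
  have hr' : (0 : ℝ) < r := Nat.cast_pos.2 hr
  refine le_csSup (bddAbove_feasibleValues _)
    ⟨r, codePattern x, fun _ => (r : ℝ)⁻¹, ⟨⟨codePattern_cliqueFree x, hx⟩,
      fun _ => inv_pos.2 hr', by simp [hr'.ne']⟩, ?_⟩
  rw [q_eq_sum]
  have : ∀ i, ∑ j, (r : ℝ)⁻¹ * (r : ℝ)⁻¹ * Real.logb 2 (((codePattern x) i j).card : ℝ)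
      = (r : ℝ)⁻¹ * v := by
    intro i
    rw [← Finset.mul_sum]
    change _ * ∑ j, Real.logb 2 ((diffSet (x i) (x j)).card : ℝ) = _
    rw [hv]
    field_simp
  rw [Finset.sum_congr rfl fun i _ => this i]
  simp [hr'.ne']

/-! ### Linear and parity-sensitive bounds on the logarithm -/

section Logarithms

/-- This is $2^3<3^2$; the bounds for 3 and 5 below are $3^3<2^5$ and $5^2<2^5$. -/
theorem three_halves_lt_logb_three : 3 / 2 < Real.logb 2 3 := by
  have h : 3 < Real.logb 2 (3 ^ 2) := by
    rw [Real.lt_logb_iff_rpow_lt (by norm_num) (by norm_num)]; norm_num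
  rw [Real.logb_pow] at h
  push_cast at h
  linarith

theorem logb_three_lt : Real.logb 2 3 < 5 / 3 := by
  rw [lt_div_iff₀ (by norm_num), mul_comm, ← Nat.cast_ofNat (n := 3), ← Real.logb_pow,
    Real.logb_lt_iff_lt_rpow (by norm_num) (by norm_num)]
  norm_num

theorem logb_four : Real.logb 2 4 = 2 := by
  rw [Real.logb_eq_iff_rpow_eq (by norm_num) (by norm_num) (by norm_num)]; norm_num

theorem logb_five_lt : Real.logb 2 5 < 5 / 2 := by
  rw [lt_div_iff₀ (by norm_num), mul_comm, ← Nat.cast_ofNat (n := 2), ← Real.logb_pow,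
    Real.logb_lt_iff_lt_rpow (by norm_num) (by norm_num)]
  norm_num

theorem logb_six : Real.logb 2 6 = 1 + Real.logb 2 3 := by
  rw [show (6 : ℝ) = 2 * 3 by norm_num, Real.logb_mul (by norm_num) (by norm_num),
    Real.logb_self_eq_one (by norm_num)]

theorem logb_two_le_linear {n : ℕ} (hn : n ≤ 2) : Real.logb 2 n ≤ 1 / 2 * n ∧
    (Real.logb 2 n = 1 / 2 * n → n = 0 ∨ n = 2) := by
  interval_cases n <;> norm_num

/-- The line meets the logarithm at 3, and at 0 through the convention `Real.logb 2 0 = 0`.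
Strictness at both 2 and 4 amounts to $\log 3>3/2$. -/
theorem logb_le_linear {n : ℕ} (hn : n ≤ 4) : Real.logb 2 n ≤ Real.logb 2 3 / 3 * n ∧
    (Real.logb 2 n = Real.logb 2 3 / 3 * n → n = 0 ∨ n = 3) := by
  have h3 := three_halves_lt_logb_three
  have h4 := logb_four
  interval_cases n <;> norm_num <;> (try constructor) <;> (try intro) <;> linarith

/-- The indicator of the odd numbers. -/
noncomputable def oddInd (n : ℕ) : ℝ := if Odd n then 1 else 0

/-- The line $n/2$ is tight at 0, 2 and 4; the odd bonus is the least that repairs it at 3. -/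
theorem logb_le_parity {n : ℕ} (hn : n ≤ 6) :
    Real.logb 2 n ≤ n / 2 + (Real.logb 2 3 - 3 / 2) * oddInd n ∧
    (Real.logb 2 n = n / 2 + (Real.logb 2 3 - 3 / 2) * oddInd n →
      n = 0 ∨ n = 2 ∨ n = 3 ∨ n = 4) := by
  have h3 := three_halves_lt_logb_three
  have h3' := logb_three_lt
  have h4 := logb_four
  have h5 := logb_five_lt
  have h6 := logb_six
  interval_cases n <;> simp [oddInd, Nat.odd_iff] <;> (try constructor) <;> (try intro) <;> linarith

end Logarithms

/-! ### The linear case -/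

/-- The strong extension property when the optimum is given by a linear bound on the logarithm. -/
theorem strongExtensionProperty_of_linear {a : ℝ} {t : ℕ} (ha : 0 < a)
    (hlog : ∀ n : ℕ, n ≤ s → Real.logb 2 n ≤ a * n ∧ (Real.logb 2 n = a * n → n = 0 ∨ n = t))
    (hst : m * s < (m + 1) * t) (hQ : a * (m * s / ((m : ℝ) + 1)) ≤ Q (constTuple (m + 2) s)) :
    StrongExtensionProperty (constTuple (m + 2) s) := by
  rintro r φ' α ⟨⟨⟨hfree', -⟩, hα⟩, hopt⟩ φ ⟨hfree, -⟩ rfl hext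
  have hm : (0 : ℝ) < (m : ℝ) + 1 := by positivity
  have hcard : ∀ A : Finset (Fin s), A.card ≤ s := fun A => by simpa using A.card_le_univ
  have hdens : ∀ c, density φ.restrict α c ≤ m / ((m : ℝ) + 1) := fun c => by
    rw [le_div_iff₀ hm, mul_comm]; exact density_le hα (hfree' c)
  have hsum : ∑ c : Fin s, (m : ℝ) / ((m : ℝ) + 1) = m * s / ((m : ℝ) + 1) := by
    simp; ring
  have hq : q φ.restrict α ≤ a * ∑ c, density φ.restrict α c := by
    rw [q_eq_sum, ← sum_mul_card, Finset.mul_sum]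
    refine Finset.sum_le_sum fun i _ => ?_
    rw [Finset.mul_sum]
    refine Finset.sum_le_sum fun j _ => ?_
    have := mul_le_mul_of_nonneg_left (hlog _ (hcard (φ.restrict i j))).1
      (mul_pos (hα.1 i) (hα.1 j)).le
    linarith
  have hle : ∑ c, density φ.restrict α c ≤ m * s / ((m : ℝ) + 1) :=
    hsum ▸ Finset.sum_le_sum fun c _ => hdens c
  -- Optimality and `hQ` reverse the Turán bound, so every colour has extremal density.
  have hge : m * s / ((m : ℝ) + 1) ≤ ∑ c, density φ.restrict α c :=
    le_of_mul_le_mul_left (by linarith) ha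
  have hQeq : Q (constTuple (m + 2) s) = a * (m * s / ((m : ℝ) + 1)) :=
    le_antisymm (by nlinarith) hQ
  have heqd : ∀ c, ((m : ℝ) + 1) * density φ.restrict α c = m := by
    intro c
    have h := (Finset.sum_eq_sum_iff_of_le fun c _ => hdens c).1
      ((le_antisymm hle hge).trans hsum.symm) c (Finset.mem_univ c)
    rw [h]; field_simp
  obtain ⟨x, hx, hbal⟩ := exists_code hα hfree' heqd
  obtain ⟨y, hy⟩ := exists_word hfree hx
  have hdist := sum_mul_card_diffSet hα hbal y
  have hdist' : ∑ i, α i * ((diffSet (x i) y).card : ℝ) = m * s / ((m : ℝ) + 1) := by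
    rw [eq_div_iff hm.ne', mul_comm]; exact hdist
  -- `Q` is now `a` times the mean distance to `y`, so the chain `hstep1`, `hstep2` is an equality
  -- at every vertex.
  rw [ext_eq_sum, hQeq, ← hdist', Finset.mul_sum] at hext
  have hstep1 : ∀ i : Fin r, α i * Real.logb 2 ((φ i.castSucc (Fin.last r)).card : ℝ) ≤
      α i * (a * ((φ i.castSucc (Fin.last r)).card : ℝ)) := fun i =>
    mul_le_mul_of_nonneg_left (hlog _ (hcard _)).1 (hα.1 i).le
  have hstep2 : ∀ i : Fin r, α i * (a * ((φ i.castSucc (Fin.last r)).card : ℝ)) ≤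
      a * (α i * ((diffSet (x i) y).card : ℝ)) := fun i => by
    have h := Nat.cast_le (α := ℝ).2 (Finset.card_le_card (hy i))
    have := mul_le_mul_of_nonneg_left h (mul_pos ha (hα.1 i)).le
    linarith
  have hterm := (Finset.sum_eq_sum_iff_of_le
    fun i _ => (hstep1 i).trans (hstep2 i)).1 hext
  have hword : ∀ i : Fin r, φ i.castSucc (Fin.last r) = diffSet (x i) y := by
    intro i
    refine Finset.eq_of_subset_of_card_le (hy i) ?_
    have h1 := hterm i (Finset.mem_univ i)
    have h2 : a * α i * ((φ i.castSucc (Fin.last r)).card : ℝ) =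
        a * α i * ((diffSet (x i) y).card : ℝ) := by
      linarith [hstep1 i, hstep2 i]
    exact_mod_cast (mul_left_cancel₀ (mul_pos ha (hα.1 i)).ne' h2).ge
  have hval : ∀ i : Fin r, (diffSet (x i) y).card = 0 ∨ (diffSet (x i) y).card = t := by
    intro i
    refine (hlog _ (hcard _)).2 ?_
    have h1 := hterm i (Finset.mem_univ i)
    rw [hword i] at h1
    refine mul_left_cancel₀ (hα.1 i).ne' ?_
    linarith
  by_contra! hcon
  have hne : ∀ i, (diffSet (x i) y).card = t := fun i => (hval i).resolve_left fun h =>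
    hcon i (isStrongClone_of_word hx hword (Finset.card_eq_zero.1 h))
  -- If all distances were `t`, the mean would be `t`, but `hst` says that it is smaller.
  simp_rw [hne, ← Finset.sum_mul, hα.2, one_mul] at hdist
  have : (m : ℝ) * s < ((m : ℝ) + 1) * t := by exact_mod_cast hst
  linarith

/-! ### Weight of the pairs with an odd number of colours -/

theorem oddInd_of_even_add {a b c : ℕ} (h : Even (a + b + c)) :
    oddInd c = oddInd a + oddInd b - 2 * (oddInd a * oddInd b) := by
  have h' : Odd c ↔ ¬ (Odd a ↔ Odd b) := by grind
  unfold oddInd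
  split_ifs <;> first | (exfalso; tauto) | norm_num

/-- In a family of three sets with empty intersection, an odd total size forces an element that
lies in exactly one of the sets. -/
theorem oddInd_card_le (A B C : Finset (Fin s)) (h : ∀ c, ¬ (c ∈ A ∧ c ∈ B ∧ c ∈ C))
    (e : Finset (Fin s) → Fin s → ℝ) (he : e = fun X c => if c ∈ X then 1 else 0) :
    oddInd C.card ≤ oddInd A.card + oddInd B.card - 2 * (oddInd A.card * oddInd B.card) +
      ∑ c, (e A c + e B c + e C c - 2 * (e A c * e B c + e A c * e C c + e B c * e C c)) := by
  -- The summand is 1 when `c` lies in exactly one set and 0 when it lies in none or two; the value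
  -- -3 for all three is excluded by `h`.
  have hnn : ∀ c ∈ Finset.univ,
      0 ≤ e A c + e B c + e C c - 2 * (e A c * e B c + e A c * e C c + e B c * e C c) := by
    intro c _
    have := h c
    subst he
    by_cases h1 : c ∈ A <;> by_cases h2 : c ∈ B <;> by_cases h3 : c ∈ C <;> simp_all <;> norm_num
  by_cases hex : ∃ c, 1 ≤ e A c + e B c + e C c -
      2 * (e A c * e B c + e A c * e C c + e B c * e C c)
  · obtain ⟨c, hc⟩ := hex
    have hsum := hc.trans (Finset.single_le_sum hnn (Finset.mem_univ c))
    have h1 : oddInd C.card ≤ 1 := by unfold oddInd; split_ifs <;> norm_num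
    have h2 : 0 ≤ oddInd A.card + oddInd B.card - 2 * (oddInd A.card * oddInd B.card) := by
      unfold oddInd; split_ifs <;> norm_num
    linarith
  · push Not at hex
    have hev : Even (A.card + B.card + C.card) := by
      have hc : ∀ X : Finset (Fin s), X.card = ∑ c, if c ∈ X then 1 else 0 := fun X => by simp
      rw [hc A, hc B, hc C, ← Finset.sum_add_distrib, ← Finset.sum_add_distrib]
      refine Finset.even_sum _ fun c _ => ?_
      have h1 := hex c
      have h2 := h c
      subst he
      by_cases h1 : c ∈ A <;> by_cases h2 : c ∈ B <;> by_cases h3 : c ∈ C <;> simp_all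
    have hsum := Finset.sum_nonneg hnn
    rw [oddInd_of_even_add hev]
    linarith

section TripleSums

variable {α : Fin r → ℝ} {g : Fin r → Fin r → ℝ}

theorem sum_triple_edge (hα : α ∈ Weighting r) :
    ∑ v, ∑ a, ∑ b, α v * α a * α b * g v a = ∑ i, ∑ j, α i * α j * g i j := by
  refine Finset.sum_congr rfl fun v _ => Finset.sum_congr rfl fun a _ => ?_
  rw [← Finset.sum_mul, ← Finset.mul_sum, hα.2, mul_one]

theorem sum_triple_path :
    ∑ v, ∑ a, ∑ b, α v * α a * α b * (g v a * g v b) = ∑ v, α v * (∑ a, α a * g v a) ^ 2 := by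
  refine Finset.sum_congr rfl fun v _ => ?_
  rw [sq, Finset.sum_mul_sum, Finset.mul_sum]
  refine Finset.sum_congr rfl fun a _ => ?_
  rw [Finset.mul_sum]
  exact Finset.sum_congr rfl fun b _ => by ring

/-- The variance of the weighted degree is nonnegative. -/
theorem sq_sum_le_sum_triple_path (hα : α ∈ Weighting r) :
    (∑ i, ∑ j, α i * α j * g i j) ^ 2 ≤ ∑ v, α v * (∑ a, α a * g v a) ^ 2 := by
  have h1 : ∑ i, ∑ j, α i * α j * g i j = ∑ v, α v * ∑ a, α a * g v a :=
    Finset.sum_congr rfl fun v _ => by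
      rw [Finset.mul_sum]; exact Finset.sum_congr rfl fun a _ => by ring
  rw [h1]
  set μ := ∑ v, α v * ∑ a, α a * g v a with hμ
  have h2 : ∀ t : ℝ, ∑ v, α v * (∑ a, α a * g v a - t) ^ 2 =
      ∑ v, α v * (∑ a, α a * g v a) ^ 2 - 2 * t * ∑ v, α v * ∑ a, α a * g v a + t ^ 2 * ∑ v, α v := by
    intro t
    simp_rw [Finset.mul_sum _ _ (2 * t), Finset.mul_sum _ _ (t ^ 2)]
    rw [← Finset.sum_sub_distrib, ← Finset.sum_add_distrib]
    exact Finset.sum_congr rfl fun v _ => by ring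
  specialize h2 μ
  rw [← hμ, hα.2] at h2
  have h3 : 0 ≤ ∑ v, α v * (∑ a, α a * g v a - μ) ^ 2 :=
    Finset.sum_nonneg fun v _ => mul_nonneg (hα.1 v).le (sq_nonneg _)
  nlinarith

/-- For a 0/1-valued `g` this bounds the chance that exactly one of `va`, `vb` is an edge; the
product term averages to the second moment of the degree. -/
theorem sum_triple_cherry_le (hα : α ∈ Weighting r) :
    ∑ v, ∑ a, ∑ b, α v * α a * α b * (g v a + g v b - 2 * (g v a * g v b)) ≤
      2 * (∑ i, ∑ j, α i * α j * g i j) - 2 * (∑ i, ∑ j, α i * α j * g i j) ^ 2 := by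
  have h1 := sum_triple_edge (g := g) hα
  have h2 : ∑ v, ∑ a, ∑ b, α v * α a * α b * g v b = ∑ i, ∑ j, α i * α j * g i j := by
    rw [← h1]
    refine Finset.sum_congr rfl fun v _ => ?_
    rw [Finset.sum_comm]
    exact Finset.sum_congr rfl fun a _ => Finset.sum_congr rfl fun b _ => by ring
  have h3 := sum_triple_path (α := α) (g := g)
  have h4 := sq_sum_le_sum_triple_path (g := g) hα
  simp only [mul_sub, mul_add, mul_left_comm _ (2 : ℝ), Finset.sum_sub_distrib,
    Finset.sum_add_distrib, ← Finset.mul_sum] at *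
  linarith

/-- By symmetry the three products have the same average, at least the squared edge density. -/
theorem sum_triple_le (hα : α ∈ Weighting r) (hg : ∀ i j, g i j = g j i) :
    ∑ v, ∑ a, ∑ b, α v * α a * α b * (g v a + g v b + g a b -
        2 * (g v a * g v b + g v a * g a b + g v b * g a b)) ≤
      3 * (∑ i, ∑ j, α i * α j * g i j) - 6 * (∑ i, ∑ j, α i * α j * g i j) ^ 2 := by
  have h1 := sum_triple_edge (g := g) hα
  have h3 := sum_triple_path (α := α) (g := g)
  have h4 := sq_sum_le_sum_triple_path (g := g) hα
  have e1 : ∑ v, ∑ a, ∑ b, α v * α a * α b * g a b = ∑ i, ∑ j, α i * α j * g i j := by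
    rw [← h1, Finset.sum_comm]
    refine Finset.sum_congr rfl fun v _ => ?_
    rw [Finset.sum_comm]
    exact Finset.sum_congr rfl fun a _ => Finset.sum_congr rfl fun b _ => by ring
  have e2 : ∑ v, ∑ a, ∑ b, α v * α a * α b * (g v a * g a b)
      = ∑ v, α v * (∑ a, α a * g v a) ^ 2 := by
    rw [← h3, Finset.sum_comm]
    refine Finset.sum_congr rfl fun v _ => Finset.sum_congr rfl fun a _ =>
      Finset.sum_congr rfl fun b _ => ?_
    rw [hg a v]; ring
  have e3 : ∑ v, ∑ a, ∑ b, α v * α a * α b * (g v b * g a b)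
      = ∑ v, α v * (∑ a, α a * g v a) ^ 2 := by
    rw [← e2]
    refine Finset.sum_congr rfl fun v _ => ?_
    rw [Finset.sum_comm]
    refine Finset.sum_congr rfl fun a _ => Finset.sum_congr rfl fun b _ => ?_
    rw [hg b a]; ring
  have h5 := sum_triple_cherry_le (g := g) hα
  have h6 : ∑ v, ∑ a, ∑ b, α v * α a * α b * (g v a + g v b + g a b -
        2 * (g v a * g v b + g v a * g a b + g v b * g a b)) =
      ∑ v, ∑ a, ∑ b, α v * α a * α b * (g v a + g v b - 2 * (g v a * g v b)) +
      ∑ v, ∑ a, ∑ b, α v * α a * α b * g a b -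
      2 * ∑ v, ∑ a, ∑ b, α v * α a * α b * (g v a * g a b) -
      2 * ∑ v, ∑ a, ∑ b, α v * α a * α b * (g v b * g a b) := by
    simp only [Finset.mul_sum, ← Finset.sum_sub_distrib, ← Finset.sum_add_distrib]
    exact Finset.sum_congr rfl fun v _ => Finset.sum_congr rfl fun a _ =>
      Finset.sum_congr rfl fun b _ => by ring
  linarith

end TripleSums

/-- If the colour graphs are triangle-free and nearly extremal, then at most about half of the pairs
receive an odd number of colours. -/
theorem sum_oddInd_le {φ : Pattern r s} {α : Fin r → ℝ} (hα : α ∈ Weighting r)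
    (hφ : ∀ c, (φ.colourGraph c).CliqueFree 3) :
    ∑ i, ∑ j, α i * α j * oddInd (φ i j).card ≤
      1 / 2 + 3 * ((s : ℝ) / 2 - ∑ c, density φ α c) := by
  set e : Finset (Fin s) → Fin s → ℝ := fun X c => if c ∈ X then 1 else 0 with he
  set o : Fin r → Fin r → ℝ := fun i j => oddInd (φ i j).card with ho
  set T : Fin s → Fin r → Fin r → Fin r → ℝ := fun c v a b =>
    e (φ v a) c + e (φ v b) c + e (φ a b) c - 2 * (e (φ v a) c * e (φ v b) c +
      e (φ v a) c * e (φ a b) c + e (φ v b) c * e (φ a b) c) with hT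
  have hdens : ∀ c, ∑ i, ∑ j, α i * α j * e (φ i j) c = density φ α c := fun c =>
    Finset.sum_congr rfl fun i _ => Finset.sum_congr rfl fun j _ => by simp [he]
  -- `oddInd_card_le` applies to the colour sets of a triple; no colour lies in all three, as that
  -- would be a monochromatic triangle.
  have hpoint : ∀ v a b, α v * α a * α b * o a b ≤
      α v * α a * α b * (o v a + o v b - 2 * (o v a * o v b)) +
        ∑ c, α v * α a * α b * T c v a b := by
    intro v a b
    rw [← Finset.mul_sum, ← mul_add]
    refine mul_le_mul_of_nonneg_left (oddInd_card_le _ _ _ ?_ e he)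
      (mul_pos (mul_pos (hα.1 v) (hα.1 a)) (hα.1 b)).le
    rintro c ⟨h1, h2, h3⟩
    refine hφ c {v, a, b} (SimpleGraph.is3Clique_triple_iff.2 ⟨h1, h2, h3⟩)
  have hleft : ∑ v, ∑ a, ∑ b, α v * α a * α b * o a b = ∑ i, ∑ j, α i * α j * o i j := by
    have h : ∀ v, ∑ a, ∑ b, α v * α a * α b * o a b = α v * ∑ i, ∑ j, α i * α j * o i j := by
      intro v
      simp only [Finset.mul_sum]
      exact Finset.sum_congr rfl fun a _ => Finset.sum_congr rfl fun b _ => by ring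
    rw [Finset.sum_congr rfl fun v _ => h v, ← Finset.sum_mul, hα.2, one_mul]
  have hright : ∑ v, ∑ a, ∑ b, ∑ c, α v * α a * α b * T c v a b =
      ∑ c, ∑ v, ∑ a, ∑ b, α v * α a * α b * T c v a b := by
    rw [Finset.sum_comm]
    rw [Finset.sum_congr rfl fun v _ => Finset.sum_congr rfl fun a _ => Finset.sum_comm]
    rw [Finset.sum_comm, Finset.sum_congr rfl fun v _ => Finset.sum_comm, Finset.sum_comm]
  have hcol : ∀ c, ∑ v, ∑ a, ∑ b, α v * α a * α b * T c v a b ≤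
      3 * (1 / 2 - density φ α c) := by
    intro c
    have h := sum_triple_le hα (g := fun i j => e (φ i j) c) fun i j => by rw [φ.symm]
    rw [hdens] at h
    refine h.trans ?_
    -- $3d-6d^2=3(1/2-d)-6(d-1/2)^2$.
    nlinarith [sq_nonneg (density φ α c - 1 / 2)]
  have hcherry := sum_triple_cherry_le (g := o) hα
  have hsum : ∑ v, ∑ a, ∑ b, α v * α a * α b * o a b ≤
      ∑ v, ∑ a, ∑ b, α v * α a * α b * (o v a + o v b - 2 * (o v a * o v b)) +
        ∑ v, ∑ a, ∑ b, ∑ c, α v * α a * α b * T c v a b := by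
    simp only [← Finset.sum_add_distrib]
    exact Finset.sum_le_sum fun v _ => Finset.sum_le_sum fun a _ => Finset.sum_le_sum fun b _ =>
      hpoint v a b
  have hcols : ∑ c, ∑ v, ∑ a, ∑ b, α v * α a * α b * T c v a b ≤
      3 * ((s : ℝ) / 2 - ∑ c, density φ α c) := by
    refine (Finset.sum_le_sum fun c _ => hcol c).trans (le_of_eq ?_)
    rw [← Finset.mul_sum, Finset.sum_sub_distrib]
    simp [div_eq_mul_inv]
  rw [hleft, hright] at hsum
  nlinarith [sq_nonneg (∑ i, ∑ j, α i * α j * o i j - 1 / 2)]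

/-! ### Sign characters and the parity-sensitive case -/

/-- The sign of a binary letter. -/
def sgn (a : Fin 2) : ℝ := if a = 0 then 1 else -1

theorem sgn_mul_sgn (a b : Fin 2) : sgn a * sgn b = if a = b then 1 else -1 := by
  fin_cases a <;> fin_cases b <;> simp [sgn]

theorem sgn_mul_self (a : Fin 2) : sgn a * sgn a = 1 := by simp [sgn_mul_sgn]

/-- The parity of the distance is a product of characters, which lets averages over the code factor.
-/
theorem oddInd_diffSet (x y : Fin s → Fin 2) :
    oddInd (diffSet x y).card = (1 - (∏ c, sgn (x c)) * ∏ c, sgn (y c)) / 2 := by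
  have h : (∏ c, sgn (x c)) * ∏ c, sgn (y c) = (-1) ^ (diffSet x y).card := by
    rw [← Finset.prod_mul_distrib]
    simp_rw [sgn_mul_sgn]
    rw [Finset.prod_ite]
    simp [diffSet]
  rw [h, oddInd]
  split_ifs with ho
  · rw [ho.neg_one_pow]; norm_num
  · rw [(Nat.not_odd_iff_even.1 ho).neg_one_pow]; norm_num

theorem sum_sgn_mul_sgn (x y : Fin s → Fin 2) :
    ∑ c, sgn (x c) * sgn (y c) = s - 2 * (diffSet x y).card := by
  have h : ∀ c, sgn (x c) * sgn (y c) = 1 - 2 * if x c ≠ y c then 1 else 0 := by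
    intro c
    rw [sgn_mul_sgn]
    by_cases hc : x c = y c <;> simp [hc]; norm_num
  rw [Finset.sum_congr rfl fun c _ => h c, Finset.sum_sub_distrib, ← Finset.mul_sum, diffSet,
    Finset.card_filter]
  push_cast
  simp

/-- The distances occurring in the optimal binary codes. -/
def IsTightDist (n : ℕ) : Prop := n = 0 ∨ n = 2 ∨ n = 3 ∨ n = 4

/-- A word at tight distances from a weighted code, with the average distance and the average parity
that tightness forces. -/
structure IsTightWord (x : Fin r → Fin s → Fin 2) (α : Fin r → ℝ) (y : Fin s → Fin 2) : Prop where
  dist : ∀ i, IsTightDist (diffSet (x i) y).card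
  mean : ∑ i, α i * ((diffSet (x i) y).card : ℝ) = s / 2
  parity : ∑ i, α i * oddInd (diffSet (x i) y).card = 1 / 2

/-- The strong extension property for triangles, when the optimum is given by a parity-sensitive bound
on the logarithm. -/
theorem strongExtensionProperty_of_parity (hs : s ≤ 6)
    (hQ : (s : ℝ) / 4 + (Real.logb 2 3 - 3 / 2) / 2 ≤ Q (constTuple 3 s))
    (hword : ∀ {r : ℕ} {x : Fin r → Fin s → Fin 2} {α : Fin r → ℝ}, α ∈ Weighting r →
      (∀ i, IsTightWord x α (x i)) → ∀ {y}, IsTightWord x α y → ∃ j, diffSet (x j) y = ∅) :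
    StrongExtensionProperty (constTuple 3 s) := by
  rintro r φ' α ⟨⟨⟨hfree', -⟩, hα⟩, hopt⟩ φ ⟨hfree, -⟩ rfl hext
  set κ := Real.logb 2 3 - 3 / 2 with hκ
  have hκ0 : 0 < κ := sub_pos.2 three_halves_lt_logb_three
  have hκ1 : κ < 1 / 6 := by linarith [logb_three_lt]
  have hlog : ∀ {n : ℕ}, n ≤ 6 → Real.logb 2 n ≤ n / 2 + κ * oddInd n ∧
    (Real.logb 2 n = n / 2 + κ * oddInd n → IsTightDist n) := logb_le_parity
  have hcard : ∀ A : Finset (Fin s), A.card ≤ 6 := fun A =>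
    (by simpa using A.card_le_univ : A.card ≤ s).trans hs
  have hdens : ∀ c, density φ.restrict α c ≤ 1 / 2 := fun c => by
    have := density_le (m := 1) hα (hfree' c)
    push_cast at this
    linarith
  have hsum : ∑ c : Fin s, (1 : ℝ) / 2 = s / 2 := by simp [div_eq_mul_inv]
  have hle : ∑ c, density φ.restrict α c ≤ s / 2 := hsum ▸ Finset.sum_le_sum fun c _ => hdens c
  have hodd := sum_oddInd_le hα hfree'
  set N := ∑ c, density φ.restrict α c with hN
  set h := ∑ i, ∑ j, α i * α j * oddInd (φ.restrict i j).card with hh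
  have hpoint : ∀ i j, 0 ≤ α i * α j * (((φ.restrict i j).card : ℝ) / 2 +
      κ * oddInd (φ.restrict i j).card - Real.logb 2 ((φ.restrict i j).card : ℝ)) := fun i j =>
    mul_nonneg (mul_pos (hα.1 i) (hα.1 j)).le (sub_nonneg.2 (hlog (hcard _)).1)
  have hslack : ∑ i, ∑ j, α i * α j * (((φ.restrict i j).card : ℝ) / 2 +
      κ * oddInd (φ.restrict i j).card - Real.logb 2 ((φ.restrict i j).card : ℝ)) =
      N / 2 + κ * h - q φ.restrict α := by
    rw [hN, ← sum_mul_card, hh, q_eq_sum, Finset.sum_div, Finset.mul_sum,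
      ← Finset.sum_add_distrib, ← Finset.sum_sub_distrib]
    refine Finset.sum_congr rfl fun i _ => ?_
    rw [Finset.sum_div, Finset.mul_sum, ← Finset.sum_add_distrib, ← Finset.sum_sub_distrib]
    exact Finset.sum_congr rfl fun j _ => by ring
  have hslack0 : 0 ≤ N / 2 + κ * h - q φ.restrict α :=
    hslack ▸ Finset.sum_nonneg fun i _ => Finset.sum_nonneg fun j _ => hpoint i j
  have hκh := mul_le_mul_of_nonneg_left hodd hκ0.le
  -- A density deficit $\delta$ loses $\delta/2$ in the linear term and gains at most
  -- $3\kappa\delta$ in the parity term; $\kappa<1/6$ rules this out for an optimum.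
  have hNs : N = s / 2 := by
    refine le_antisymm hle ?_
    by_contra hlt
    push Not at hlt
    have : 0 < (1 / 2 - 3 * κ) * ((s : ℝ) / 2 - N) :=
      mul_pos (by linarith) (sub_pos.2 hlt)
    rw [hopt] at hslack0
    nlinarith
  rw [hNs] at hslack hslack0 hodd hκh
  have hh2 : h = 1 / 2 := by
    refine le_antisymm (by linarith) (le_of_mul_le_mul_left ?_ hκ0)
    linarith
  have hQeq : Q (constTuple 3 s) = s / 4 + κ / 2 := by
    rw [hh2] at hslack0
    linarith
  have hdist : ∀ i j, IsTightDist (φ.restrict i j).card := by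
    intro i j
    have h0 : (s : ℝ) / 2 / 2 + κ * h - q φ.restrict α = 0 := by rw [hh2, hopt, hQeq]; ring
    have h1 := (Finset.sum_eq_zero_iff_of_nonneg fun i _ =>
      Finset.sum_nonneg fun j _ => hpoint i j).1 (hslack.trans h0) i (Finset.mem_univ i)
    have h2 := (Finset.sum_eq_zero_iff_of_nonneg fun j _ => hpoint i j).1 h1 j (Finset.mem_univ j)
    have h3 := (mul_eq_zero.1 h2).resolve_left (mul_pos (hα.1 i) (hα.1 j)).ne'
    exact (hlog (hcard _)).2 (by linarith)
  have heqd : ∀ c, (((1 : ℕ) : ℝ) + 1) * density φ.restrict α c = (1 : ℕ) := by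
    intro c
    have h := (Finset.sum_eq_sum_iff_of_le fun c _ => hdens c).1
      (hNs.trans hsum.symm) c (Finset.mem_univ c)
    rw [h]; norm_num
  obtain ⟨x, hx, hbal⟩ := exists_code (m := 1) hα hfree' heqd
  obtain ⟨y, hy⟩ := exists_word hfree hx
  have hmean : ∀ z : Fin s → Fin 2, ∑ i, α i * ((diffSet (x i) z).card : ℝ) = s / 2 := by
    intro z
    have := sum_mul_card_diffSet hα hbal z
    push_cast at this
    linarith
  have hparity : ∀ z : Fin s → Fin 2, ∑ i, α i * oddInd (diffSet (x i) z).card = 1 / 2 := by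
    have hlin : ∀ z : Fin s → Fin 2, ∑ i, α i * oddInd (diffSet (x i) z).card =
        (1 - (∑ i, α i * ∏ c, sgn (x i c)) * ∏ c, sgn (z c)) / 2 := by
      intro z
      have h1 : ∀ i, α i * oddInd (diffSet (x i) z).card =
          (α i - α i * (∏ c, sgn (x i c)) * ∏ c, sgn (z c)) / 2 := fun i => by
        rw [oddInd_diffSet]; ring
      rw [Finset.sum_congr rfl fun i _ => h1 i, ← Finset.sum_div, Finset.sum_sub_distrib,
        ← Finset.sum_mul, hα.2]
    -- `μ` is the mean of the full parity character. Since $h=(1-\mu^2)/2$, the value $h=1/2$ forces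
    -- $\mu=0$, so parity is balanced relative to every word.
    set μ := ∑ i, α i * ∏ c, sgn (x i c) with hμ
    have h2 : h = (1 - μ * μ) / 2 := by
      have h3 : ∀ i, ∑ j, α i * α j * oddInd (φ.restrict i j).card =
          (α i - μ * (α i * ∏ c, sgn (x i c))) / 2 := by
        intro i
        have h4 : ∀ j, α i * α j * oddInd (φ.restrict i j).card =
            α i * (α j * oddInd (diffSet (x j) (x i)).card) := fun j => by
          rw [φ.restrict.symm, hx]; ring
        rw [Finset.sum_congr rfl fun j _ => h4 j, ← Finset.mul_sum, hlin]
        ring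
      rw [hh, Finset.sum_congr rfl fun i _ => h3 i, ← Finset.sum_div, Finset.sum_sub_distrib,
        ← Finset.mul_sum, hα.2, ← hμ]
    have hμ0 : μ = 0 := by
      have : μ * μ = 0 := by linarith
      exact mul_self_eq_zero.1 this
    intro z
    rw [hlin, hμ0]
    norm_num
  have htight : ∀ i, IsTightWord x α (x i) := fun i =>
    ⟨fun j => hx j i ▸ hdist j i, hmean _, hparity _⟩
  -- Each colour missing from the difference set costs $1/2$ in the linear term and recovers at most
  -- $\kappa<1/2$ through parity.
  have hoddle : ∀ i : Fin r, oddInd (φ i.castSucc (Fin.last r)).card ≤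
      oddInd (diffSet (x i) y).card +
        (((diffSet (x i) y).card : ℝ) - ((φ i.castSucc (Fin.last r)).card : ℝ)) := by
    intro i
    rcases (Finset.card_le_card (hy i)).eq_or_lt with heq | hlt
    · rw [heq]; simp
    · have h1 : ((φ i.castSucc (Fin.last r)).card : ℝ) + 1 ≤ ((diffSet (x i) y).card : ℝ) := by
        exact_mod_cast hlt
      have h2 : oddInd (φ i.castSucc (Fin.last r)).card ≤ 1 := by
        unfold oddInd; split_ifs <;> norm_num
      have h3 : 0 ≤ oddInd (diffSet (x i) y).card := by
        unfold oddInd; split_ifs <;> norm_num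
      linarith
  have hbound : ∀ i : Fin r, Real.logb 2 ((φ i.castSucc (Fin.last r)).card : ℝ) +
      (1 / 2 - κ) * (((diffSet (x i) y).card : ℝ) - ((φ i.castSucc (Fin.last r)).card : ℝ)) ≤
      ((diffSet (x i) y).card : ℝ) / 2 + κ * oddInd (diffSet (x i) y).card := by
    intro i
    have h1 := (hlog (hcard (φ i.castSucc (Fin.last r)))).1
    have h2 := mul_le_mul_of_nonneg_left (hoddle i) hκ0.le
    linarith
  have hgap : ∀ i : Fin r, 0 ≤ (1 / 2 - κ) *
      (((diffSet (x i) y).card : ℝ) - ((φ i.castSucc (Fin.last r)).card : ℝ)) := fun i =>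
    mul_nonneg (by linarith) (sub_nonneg.2 (Nat.cast_le.2 (Finset.card_le_card (hy i))))
  have htotal : ∑ i, α i * (((diffSet (x i) y).card : ℝ) / 2 +
      κ * oddInd (diffSet (x i) y).card) = Q (constTuple 3 s) := by
    have h1 : ∀ i, α i * (((diffSet (x i) y).card : ℝ) / 2 + κ * oddInd (diffSet (x i) y).card) =
        α i * ((diffSet (x i) y).card : ℝ) / 2 + κ * (α i * oddInd (diffSet (x i) y).card) :=
      fun i => by ring
    rw [Finset.sum_congr rfl fun i _ => h1 i, Finset.sum_add_distrib, ← Finset.sum_div,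
      ← Finset.mul_sum, hmean, hparity, hQeq]
    ring
  have hterm := (Finset.sum_eq_sum_iff_of_le fun i _ => mul_le_mul_of_nonneg_left
    (by linarith [hbound i, hgap i] : Real.logb 2 ((φ i.castSucc (Fin.last r)).card : ℝ) ≤
      ((diffSet (x i) y).card : ℝ) / 2 + κ * oddInd (diffSet (x i) y).card) (hα.1 i).le).1
    ((ext_eq_sum φ α).symm.trans (hext.trans htotal.symm))
  have hterm' : ∀ i : Fin r, Real.logb 2 ((φ i.castSucc (Fin.last r)).card : ℝ) =
      ((diffSet (x i) y).card : ℝ) / 2 + κ * oddInd (diffSet (x i) y).card := fun i =>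
    mul_left_cancel₀ (hα.1 i).ne' (hterm i (Finset.mem_univ i))
  have hphi : ∀ i : Fin r, φ i.castSucc (Fin.last r) = diffSet (x i) y := by
    intro i
    refine Finset.eq_of_subset_of_card_le (hy i) ?_
    have h1 : (1 / 2 - κ) * (((diffSet (x i) y).card : ℝ) -
        ((φ i.castSucc (Fin.last r)).card : ℝ)) = 0 :=
      le_antisymm (by linarith [hbound i, hterm' i]) (hgap i)
    have h2 := (mul_eq_zero.1 h1).resolve_left (by linarith)
    exact_mod_cast (sub_eq_zero.1 h2).le
  obtain ⟨j, hj⟩ := hword hα htight (y := y)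
    ⟨fun i => (hlog (hcard _)).2 (hphi i ▸ hterm' i), hmean y, hparity y⟩
  exact ⟨j, isStrongClone_of_word hx hphi hj⟩

/-! ### Tight words belong to the code -/

/-- A tight word of length four belongs to the code. -/
theorem exists_diffSet_eq_empty_of_four {x : Fin r → Fin 4 → Fin 2} {α : Fin r → ℝ}
    (hα : α ∈ Weighting r) {y : Fin 4 → Fin 2} (hy : IsTightWord x α y) :
    ∃ j, diffSet (x j) y = ∅ := by
  by_contra! hcon
  -- Nonzero tight distances $n$ satisfy $n\ge 2+\mathrm{odd}(n)$; averaging would give a mean of at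
  -- least $5/2$, but it is 2.
  have h1 : ∀ i, α i * (2 + oddInd (diffSet (x i) y).card) ≤
      α i * ((diffSet (x i) y).card : ℝ) := by
    intro i
    refine mul_le_mul_of_nonneg_left ?_ (hα.1 i).le
    have h0 : (diffSet (x i) y).card ≠ 0 := fun h =>
      (hcon i).ne_empty (Finset.card_eq_zero.1 h)
    rcases hy.dist i with h | h | h | h
    · exact absurd h h0
    all_goals rw [h]; simp [oddInd, Nat.odd_iff]; try norm_num
  have h2 := Finset.sum_le_sum fun i (_ : i ∈ Finset.univ) => h1 i
  rw [hy.mean, Finset.sum_congr rfl fun i _ => mul_add (α i) 2 _, Finset.sum_add_distrib,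
    ← Finset.sum_mul, hα.2, hy.parity] at h2
  norm_num at h2

/-- A tight word of length six belongs to the code: the pairwise correlations of the coordinates
of a tight code vanish, which determines the second moment of the distance to any word. -/
theorem exists_diffSet_eq_empty_of_six {x : Fin r → Fin 6 → Fin 2} {α : Fin r → ℝ}
    (hα : α ∈ Weighting r) (hx : ∀ i, IsTightWord x α (x i)) {y : Fin 6 → Fin 2}
    (hy : IsTightWord x α y) : ∃ j, diffSet (x j) y = ∅ := by
  by_contra! hcon
  set M : Fin 6 → Fin 6 → ℝ := fun c d => ∑ i, α i * (sgn (x i c) * sgn (x i d)) with hM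
  have hsecond : ∀ z : Fin 6 → Fin 2, ∑ i, α i * (∑ c, sgn (x i c) * sgn (z c)) ^ 2 =
      ∑ c, ∑ d, M c d * (sgn (z c) * sgn (z d)) := by
    intro z
    have h1 : ∀ i, α i * (∑ c, sgn (x i c) * sgn (z c)) ^ 2 =
        ∑ c, ∑ d, α i * (sgn (x i c) * sgn (x i d)) * (sgn (z c) * sgn (z d)) := by
      intro i
      rw [sq, Finset.sum_mul_sum, Finset.mul_sum]
      refine Finset.sum_congr rfl fun c _ => ?_
      rw [Finset.mul_sum]
      exact Finset.sum_congr rfl fun d _ => by ring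
    rw [Finset.sum_congr rfl fun i _ => h1 i, Finset.sum_comm]
    refine Finset.sum_congr rfl fun c _ => ?_
    rw [Finset.sum_comm]
    exact Finset.sum_congr rfl fun d _ => (Finset.sum_mul _ _ _).symm
  have hdiag : ∀ c, M c c = 1 := fun c => by simp [hM, sgn_mul_self, hα.2]
  have hmoment : ∀ z, IsTightWord x α z → ∑ i, α i * (∑ c, sgn (x i c) * sgn (z c)) ^ 2 ≤ 6 := by
    intro z hz
    have h1 : ∀ i, α i * (∑ c, sgn (x i c) * sgn (z c)) ^ 2 ≤
        α i * 36 - 8 * (α i * ((diffSet (x i) z).card : ℝ)) -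
          12 * (α i * oddInd (diffSet (x i) z).card) := by
      intro i
      -- The sum is $6-2n$ at distance $n$. The right side equals its square at 0, 3 and 4, exceeds
      -- it at 2, and averages to $36-24-6=6$.
      have h2 : (∑ c, sgn (x i c) * sgn (z c)) ^ 2 ≤
          36 - 8 * ((diffSet (x i) z).card : ℝ) - 12 * oddInd (diffSet (x i) z).card := by
        rw [sum_sgn_mul_sgn]
        rcases hz.dist i with h | h | h | h <;> rw [h] <;> simp [oddInd, Nat.odd_iff] <;> norm_num
      have := mul_le_mul_of_nonneg_left h2 (hα.1 i).le
      linarith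
    refine (Finset.sum_le_sum fun i _ => h1 i).trans ?_
    rw [Finset.sum_sub_distrib, Finset.sum_sub_distrib, ← Finset.mul_sum, ← Finset.mul_sum,
      ← Finset.sum_mul, hz.mean, hz.parity, hα.2]
    norm_num
  -- The sum of squared entries of `M` is the average over codewords of the second moment just
  -- bounded. The unit diagonal already contributes 6, so `M` is the identity.
  have hsq : ∑ c, ∑ d, M c d ^ 2 ≤ 6 := by
    have h1 : ∑ c, ∑ d, M c d ^ 2 =
        ∑ i, α i * ∑ j, α j * (∑ c, sgn (x j c) * sgn (x i c)) ^ 2 := by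
      simp_rw [hsecond, Finset.mul_sum]
      symm
      rw [Finset.sum_comm]
      refine Finset.sum_congr rfl fun c _ => ?_
      rw [Finset.sum_comm]
      refine Finset.sum_congr rfl fun d _ => ?_
      have h2 : M c d ^ 2 = M c d * ∑ i, α i * (sgn (x i c) * sgn (x i d)) := sq _
      rw [h2, Finset.mul_sum]
      exact Finset.sum_congr rfl fun i _ => by ring
    rw [h1]
    refine (Finset.sum_le_sum fun i _ => mul_le_mul_of_nonneg_left (hmoment _ (hx i))
      (hα.1 i).le).trans (le_of_eq ?_)
    rw [← Finset.sum_mul, hα.2, one_mul]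
  have hMid : ∀ c d, M c d = if c = d then 1 else 0 := by
    have h1 : ∑ c, ∑ d, (M c d - if c = d then 1 else 0) ^ 2 = ∑ c, ∑ d, M c d ^ 2 - 6 := by
      have h2 : ∀ c d, (M c d - if c = d then 1 else 0) ^ 2 = M c d ^ 2 - if c = d then 1 else 0 := by
        intro c d
        by_cases h : c = d
        · subst h; simp [hdiag]
        · simp [h]
      simp_rw [h2, Finset.sum_sub_distrib]
      simp
    have h3 : ∑ c, ∑ d, (M c d - if c = d then 1 else 0) ^ 2 = 0 :=
      le_antisymm (by linarith)
        (Finset.sum_nonneg fun c _ => Finset.sum_nonneg fun d _ => sq_nonneg _)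
    intro c d
    have h4 := (Finset.sum_eq_zero_iff_of_nonneg fun c _ =>
      Finset.sum_nonneg fun d _ => sq_nonneg _).1 h3 c (Finset.mem_univ c)
    have h5 := (Finset.sum_eq_zero_iff_of_nonneg fun d _ => sq_nonneg _).1 h4 d (Finset.mem_univ d)
    exact sub_eq_zero.1 (pow_eq_zero_iff two_ne_zero |>.1 h5)
  have hsix : ∑ i, α i * (∑ c, sgn (x i c) * sgn (y c)) ^ 2 = 6 := by
    rw [hsecond]
    simp [hMid, sgn_mul_self]
  -- Without distance 0, $(6-2n)^2$ is 4 at even and 0 at odd tight distances, so balanced parity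
  -- gives 2, contradicting `hsix`.
  have htwo : ∑ i, α i * (∑ c, sgn (x i c) * sgn (y c)) ^ 2 = 2 := by
    have h1 : ∀ i, α i * (∑ c, sgn (x i c) * sgn (y c)) ^ 2 =
        α i * 4 - 4 * (α i * oddInd (diffSet (x i) y).card) := by
      intro i
      have h0 : (diffSet (x i) y).card ≠ 0 := fun h =>
        (hcon i).ne_empty (Finset.card_eq_zero.1 h)
      have h2 : (∑ c, sgn (x i c) * sgn (y c)) ^ 2 = 4 - 4 * oddInd (diffSet (x i) y).card := by
        rw [sum_sgn_mul_sgn]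
        rcases hy.dist i with h | h | h | h
        · exact absurd h h0
        all_goals rw [h]; simp [oddInd, Nat.odd_iff]; try norm_num
      rw [h2]
      ring
    rw [Finset.sum_congr rfl fun i _ => h1 i, Finset.sum_sub_distrib, ← Finset.mul_sum,
      ← Finset.sum_mul, hy.parity, hα.2]
    norm_num
  linarith

/-! ### Optimal codes -/

/-- The repetition code shows that `Q(k; s)` is at least the value of the complete pattern. -/
theorem le_Q_repetition (hs : 2 ≤ s) :
    Real.logb 2 s / s * (m * s / ((m : ℝ) + 1)) ≤ Q (constTuple (m + 2) s) := by
  have hcard : ∀ i j : Fin (m + 1), (diffSet (fun _ : Fin s => i) (fun _ => j)).card =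
      if i = j then 0 else s := by
    intro i j
    by_cases h : i = j <;> simp [diffSet, h]
  refine le_Q_of_code (Nat.succ_pos m) (fun i _ => i) (fun i j hij => ?_) fun i => ?_
  · rw [hcard, if_neg hij]; exact hs
  · have h1 : ∀ j, Real.logb 2 ((diffSet (fun _ : Fin s => i) (fun _ => j)).card : ℝ) =
        Real.logb 2 s - if i = j then Real.logb 2 s else 0 := fun j => by
      rw [hcard]; split_ifs <;> simp
    have hs0 : (s : ℝ) ≠ 0 := by positivity
    rw [Finset.sum_congr rfl fun j _ => h1 j, Finset.sum_sub_distrib]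
    simp
    field_simp
    ring

/-- The ternary tetracode. -/
def tetracode (i : Fin 9) : Fin 4 → Fin 3 :=
  ![Fin.ofNat 3 (i / 3), Fin.ofNat 3 i, Fin.ofNat 3 (i / 3 + i), Fin.ofNat 3 (i / 3 + 2 * i)]

/-- The words are $(a,b,a+b,a+2b)$ over $\mathbb F_3$; these four functionals are pairwise
independent, so a nonzero word has exactly one zero. -/
theorem card_diffSet_tetracode : ∀ i j, (diffSet (tetracode i) (tetracode j)).card =
    if i = j then 0 else 3 := by
  decide

theorem le_Q_tetracode : Real.logb 2 3 / 3 * ((2 : ℕ) * (4 : ℕ) / (((2 : ℕ) : ℝ) + 1)) ≤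
    Q (constTuple 4 4) := by
  refine le_Q_of_code (m := 2) (r := 9) (by norm_num) tetracode (fun i j hij => ?_) fun i => ?_
  · rw [card_diffSet_tetracode, if_neg hij]; norm_num
  · have h1 : ∀ j, Real.logb 2 ((diffSet (tetracode i) (tetracode j)).card : ℝ) =
        Real.logb 2 3 - if i = j then Real.logb 2 3 else 0 := fun j => by
      rw [card_diffSet_tetracode]; split_ifs <;> simp
    rw [Finset.sum_congr rfl fun j _ => h1 j, Finset.sum_sub_distrib]
    simp
    ring

/-- An optimal binary code of length four. -/
def binaryFourCode : Fin 4 → Fin 4 → Fin 2 :=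
  ![![0, 0, 0, 0], ![1, 1, 0, 0], ![0, 1, 1, 1], ![1, 0, 1, 1]]

theorem card_diffSet_binaryFourCode : ∀ i j,
    (diffSet (binaryFourCode i) (binaryFourCode j)).card =
      ![![0, 2, 3, 3], ![2, 0, 3, 3], ![3, 3, 0, 2], ![3, 3, 2, 0]] i j := by
  decide

theorem le_Q_binaryFourCode :
    ((4 : ℕ) : ℝ) / 4 + (Real.logb 2 3 - 3 / 2) / 2 ≤ Q (constTuple 3 4) := by
  refine le_Q_of_code (m := 1) (r := 4) (by norm_num) binaryFourCode ?_ fun i => ?_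
  · decide
  · simp_rw [card_diffSet_binaryFourCode]
    fin_cases i <;> simp [Fin.sum_univ_four] <;> ring

/-- The binary simplex code of length seven, punctured in the coordinate given by the all-one vector. -/
def puncturedSimplexCode : Fin 8 → Fin 6 → Fin 2 :=
  ![![0, 0, 0, 0, 0, 0], ![1, 0, 1, 0, 1, 0],
    ![0, 1, 1, 0, 0, 1], ![1, 1, 0, 0, 1, 1],
    ![0, 0, 0, 1, 1, 1], ![1, 0, 1, 1, 0, 1],
    ![0, 1, 1, 1, 1, 0], ![1, 1, 0, 1, 0, 0]]

/-- All nonzero distances in the simplex code are 4; puncturing lowers one to 3 exactly when the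
indices differ in binary digit-sum parity. -/
theorem card_diffSet_puncturedSimplexCode : ∀ i j,
    (diffSet (puncturedSimplexCode i) (puncturedSimplexCode j)).card =
      if i = j then 0 else if (i = 0 ∨ i = 3 ∨ i = 5 ∨ i = 6 ↔ j = 0 ∨ j = 3 ∨ j = 5 ∨ j = 6)
        then 4 else 3 := by
  decide

theorem le_Q_puncturedSimplexCode :
    ((6 : ℕ) : ℝ) / 4 + (Real.logb 2 3 - 3 / 2) / 2 ≤ Q (constTuple 3 6) := by
  refine le_Q_of_code (m := 1) (r := 8) (by norm_num) puncturedSimplexCode ?_ fun i => ?_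
  · decide
  · simp_rw [card_diffSet_puncturedSimplexCode]
    have h4 := logb_four
    fin_cases i <;> simp [Fin.sum_univ_eight, h4] <;> ring

end ErdosRothschild

open ErdosRothschild in
theorem mainTheorem11 :
    (∀ k : ℕ, 3 ≤ k → StrongExtensionProperty (constTuple k 2)) ∧
    (∀ k : ℕ, 3 ≤ k → StrongExtensionProperty (constTuple k 3)) ∧
    StrongExtensionProperty (constTuple 3 4) ∧
    StrongExtensionProperty (constTuple 3 6) ∧
    StrongExtensionProperty (constTuple 4 4) := by
  have hL : 0 < Real.logb 2 3 / 3 := by linarith [three_halves_lt_logb_three]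
  refine ⟨fun k hk => ?_, fun k hk => ?_, ?_, ?_, ?_⟩
  · obtain ⟨m, rfl⟩ := Nat.exists_eq_add_of_le' (by omega : 2 ≤ k)
    exact strongExtensionProperty_of_linear (a := 1 / 2) (t := 2) (by norm_num)
      (fun n hn => logb_two_le_linear hn) (by omega) (by simpa using le_Q_repetition (m := m) le_rfl)
  · obtain ⟨m, rfl⟩ := Nat.exists_eq_add_of_le' (by omega : 2 ≤ k)
    exact strongExtensionProperty_of_linear (t := 3) hL
      (fun n hn => logb_le_linear (by omega)) (by omega)
      (by simpa using le_Q_repetition (m := m) (s := 3) (by norm_num))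
  · exact strongExtensionProperty_of_parity (by norm_num) le_Q_binaryFourCode
      fun hα _ _ hy => exists_diffSet_eq_empty_of_four hα hy
  · exact strongExtensionProperty_of_parity le_rfl le_Q_puncturedSimplexCode
      fun hα hx _ hy => exists_diffSet_eq_empty_of_six hα hx hy
  -- The mean distance here is $8/3<3$.
  · exact strongExtensionProperty_of_linear (m := 2) (t := 3) hL
      (fun n hn => logb_le_linear hn) (by norm_num) le_Q_tetracode
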